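/- Let $G$ be an uncountable Polish group and let $P(G)$ be the space of all Borel probability measures on $G$, equipped with the weak* topology (the topology of weak convergence of measures). A universally measurable set $A\subseteq G$ (one that is measurable with respect to the completion of every $\sigma$-finite Borel measure on $G$) is called generically left Haar-null if the set $$T_l(A)=\{\mu\in P(G) : \mu(gA)=0 \text{ for all } g\in G\}$$ is co-meager in $P(G)$, where $\mu$ also denotes the completion of $\mu$. If $H$ is an analytic subgroup of $G$ with empty interior, then $H$ is generically left Haar-null (in particular, $H$ is universally measurable). -/

import Mathlib

open MeasureTheory
open scoped Pointwise

/-- A subset of a measurable space (in the theorem: a Polish space with its Borel `σ`-algebra)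
is universally measurable if it is measurable for the completion of every `σ`-finite measure. -/
def IsUniversallyMeasurable {X : Type*} [MeasurableSpace X] (A : Set X) : Prop :=
  ∀ μ : Measure X, SigmaFinite μ → NullMeasurableSet A μ

/-- `T_l(A)`: the Borel probability measures that vanish on all left translates `gA` of `A`.
On a set that is null-measurable for `μ`, the value of `μ` is that of the completion of `μ`. -/
def leftNullMeasures {G : Type*} [Group G] [MeasurableSpace G] (A : Set G) :
    Set (ProbabilityMeasure G) :=
  {μ | ∀ g : G, (μ : Measure G) (g • A) = 0}

/-- A universally measurable set `A` is generically left Haar-null if `T_l(A)` is co-meager in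
the space of Borel probability measures, with the topology of weak convergence. -/
def IsGenericallyLeftHaarNull {G : Type*} [Group G] [TopologicalSpace G] [MeasurableSpace G]
    [BorelSpace G] (A : Set G) : Prop :=
  IsUniversallyMeasurable A ∧ leftNullMeasures A ∈ residual (ProbabilityMeasure G)

open Set Filter Topology

/-! Analytic sets are universally measurable and have the Baire property, so by Pettis' argument
`H`, having empty interior, is meager: it is covered by countably many nowhere dense closed sets
`F`. All cosets are treated at once through the closed relations `E = {(x, y) | x⁻¹ * y ∈ F}`, which
have meager sections and whose union contains the square of every coset. It remains to see that `(μ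
× μ)(E) = 0` for generic `μ`. The condition `(μ × μ)(E) < 1/n` is open by the portmanteau theorem,
and dense because finitely supported measures with small atoms at pairwise unrelated points are
dense. -/

/-- Suslin's operation modulo a `σ`-ideal (dual to the filter `l`): if every set `s` has a hull
in the class `M`, that is, a superset in `M` that is minimal up to the ideal, then every analytic
set has a superset in `M` from which it differs by a set in the ideal. -/
theorem MeasureTheory.AnalyticSet.exists_superset_compl_diff_mem {X : Type*} [TopologicalSpace X]
    [T3Space X] {A : Set X} (hA : AnalyticSet A) (l : Filter X) [CountableInterFilter l]
    (M : Set X → Prop) (hM : ∀ B : ℕ → Set X, (∀ n, M (B n)) → M (⋃ n, B n))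
    (hull : ∀ s, ∃ B, s ⊆ B ∧ B ⊆ closure s ∧ M B ∧ ∀ C, M C → s ⊆ C → (B \ C)ᶜ ∈ l) :
    ∃ B, A ⊆ B ∧ M B ∧ (B \ A)ᶜ ∈ l := by
  choose h hsub hcl hMh hmin using hull
  rw [AnalyticSet] at hA
  rcases hA with rfl | ⟨f, hf, rfl⟩
  · have : h ∅ = ∅ := by simpa using hcl ∅
    exact ⟨h ∅, hsub _, hMh _, by simp [this]⟩
  -- `S u` is the image of the cylinder of the finite sequence `u`, read backwards
  let S : List ℕ → Set X := fun u => f '' {x | PiNat.res x u.length = u}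
  have hS : ∀ u, S u ⊆ ⋃ n, h (S (n :: u)) := by
    rintro u _ ⟨x, hx, rfl⟩
    refine mem_iUnion.2 ⟨x u.length, hsub _ ⟨x, ?_, rfl⟩⟩
    simpa using hx
  have hnull : ∀ u, (h (S u) \ ⋃ n, h (S (n :: u)))ᶜ ∈ l := fun u =>
    hmin _ _ (hM _ fun n => hMh _) (hS u)
  have hS0 : S [] = range f := by simp [S]
  refine ⟨h (range f), hsub _, hMh _, ?_⟩
  -- Off countably many exceptional sets, a point in the hull of a cylinder's image lies in the hull
  -- for some subcylinder. Iterating traces a branch `z`; by continuity at `z` the images shrink to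
  -- `f z`, which forces `x = f z`.
  filter_upwards [eventually_countable_forall.2 hnull] with x hx
  simp only [mem_compl_iff, Set.mem_sdiff, not_and, not_not] at hx ⊢
  intro hx0
  have step : ∀ u : {u // x ∈ h (S u)}, ∃ n, x ∈ h (S (n :: u.1)) := fun u =>
    mem_iUnion.1 (hx u.1 u.2)
  choose g hg using step
  let b : ℕ → {u // x ∈ h (S u)} := fun n =>
    Nat.rec ⟨[], by rwa [hS0]⟩ (fun _ u => ⟨g u :: u.1, hg u⟩) n
  let z : ℕ → ℕ := fun n => g (b n)
  have hz : ∀ n, (b n).1 = PiNat.res z n := by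
    intro n
    induction n with
    | zero => rfl
    | succ n ih => rw [PiNat.res_succ, ← ih]
  have hclos : ∀ n, x ∈ closure (f '' PiNat.cylinder z n) := by
    intro n
    have := hcl _ (b n).2
    rwa [hz, show S (PiNat.res z n) = f '' PiNat.cylinder z n by
      simp [S, PiNat.cylinder_eq_res]] at this
  refine ⟨z, by_contra fun hne => ?_⟩
  obtain ⟨C, ⟨hCz, hC⟩, hxC⟩ := (closed_nhds_basis (f z)).mem_iff.1
    (isOpen_compl_singleton.mem_nhds (show f z ∈ ({x}ᶜ : Set X) from hne))
  obtain ⟨_, ⟨y, n, rfl⟩, hzy, hyC⟩ := (PiNat.isTopologicalBasis_cylinders _).mem_nhds_iff.1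
    (hf.continuousAt.preimage_mem_nhds hCz)
  rw [← PiNat.mem_cylinder_iff_eq.1 hzy] at hyC
  exact hxC (closure_minimal (image_subset_iff.2 hyC) hC (hclos n)) rfl

theorem MeasureTheory.AnalyticSet.nullMeasurableSet {X : Type*} [TopologicalSpace X] [T3Space X]
    [MeasurableSpace X] [OpensMeasurableSpace X] {A : Set X} (hA : AnalyticSet A)
    (μ : Measure X) [SigmaFinite μ] : NullMeasurableSet A μ := by
  obtain ⟨B, hAB, hB, hBA⟩ := hA.exists_superset_compl_diff_mem (ae μ) MeasurableSet
    (fun B hB => .iUnion hB) fun s => by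
      refine ⟨toMeasurable μ s ∩ closure s,
        subset_inter (subset_toMeasurable _ _) subset_closure, inter_subset_right,
        (measurableSet_toMeasurable _ _).inter isClosed_closure.measurableSet, fun C hC hsC => ?_⟩
      rw [mem_ae_iff, compl_compl]
      refine measure_mono_null (t := toMeasurable μ s ∩ Cᶜ)
        (fun x hx => ⟨hx.1.1, hx.2⟩) ?_
      rw [Measure.measure_toMeasurable_inter_of_sFinite hC.compl,
        (disjoint_compl_right_iff_subset.2 hsC).inter_eq, measure_empty]
  rw [mem_ae_iff, compl_compl] at hBA
  have := (hB.nullMeasurableSet (μ := μ)).diff (NullMeasurableSet.of_null hBA)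
  rwa [sdiff_sdiff_cancel_left hAB] at this

/-- The hull removes from `closure s` the largest open set `U` in which `s` is meager, then restores
the meager part `s ∩ U`. It is minimal: if the complement of `C ⊇ s` agrees with an open `W` modulo
meager sets, then `s` is meager in `W`, so `W ⊆ U`. -/
theorem MeasureTheory.AnalyticSet.baireMeasurableSet {X : Type*} [TopologicalSpace X] [T3Space X]
    [SecondCountableTopology X] {A : Set X} (hA : AnalyticSet A) : BaireMeasurableSet A := by
  obtain ⟨B, hAB, hB, hBA⟩ := hA.exists_superset_compl_diff_mem (residual X) BaireMeasurableSet
    (fun B hB => .iUnion hB) fun s => by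
      let 𝒱 : Set (Set X) := {V ∈ TopologicalSpace.countableBasis X | IsMeagre (s ∩ V)}
      have h𝒱 : 𝒱.Countable := (TopologicalSpace.countable_countableBasis X).mono fun V hV => hV.1
      let U := ⋃ V ∈ 𝒱, V
      have hU : IsOpen U := isOpen_biUnion fun V hV =>
        TopologicalSpace.isOpen_of_mem_countableBasis hV.1
      have hsU : IsMeagre (s ∩ U) := by
        simp only [U, inter_iUnion]
        exact isMeagre_biUnion h𝒱 fun V hV => hV.2
      refine ⟨closure s \ U ∪ s ∩ U, fun x hx => ?_, ?_,
        (isClosed_closure.isOpen_compl.baireMeasurableSet.of_compl.diff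
          hU.baireMeasurableSet).union hsU.baireMeasurableSet, fun C hC hsC => ?_⟩
      · by_cases h : x ∈ U
        exacts [.inr ⟨hx, h⟩, .inl ⟨subset_closure hx, h⟩]
      · exact union_subset sdiff_subset (inter_subset_left.trans subset_closure)
      · obtain ⟨W, hW, hCW⟩ := hC.compl.residualEq_isOpen
        have hWU : W ⊆ U := by
          intro x hx
          obtain ⟨V, hV, hxV, hVW⟩ :=
            (TopologicalSpace.isBasis_countableBasis X).exists_subset_of_mem_open hx hW
          refine mem_biUnion (show V ∈ 𝒱 from ⟨hV, ?_⟩) hxV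
          change (s ∩ V)ᶜ ∈ residual X
          filter_upwards [hCW.mem_iff] with y hy hyV
          exact hy.2 (hVW hyV.2) (hsC hyV.1)
        filter_upwards [hCW.mem_iff, hsU] with y hy hyU hyB
        rcases hyB.1 with h | h
        exacts [h.2 (hWU (hy.1 hyB.2)), hyU h]
  have := hB.diff (IsMeagre.baireMeasurableSet hBA)
  rwa [sdiff_sdiff_cancel_left hAB] at this

/-- Pettis' theorem for subgroups. -/
theorem Subgroup.isMeagre_of_interior_eq_empty {G : Type*} [Group G] [TopologicalSpace G]
    [IsTopologicalGroup G] [BaireSpace G] {H : Subgroup G} (hH : BaireMeasurableSet (H : Set G))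
    (hint : interior (H : Set G) = ∅) : IsMeagre (H : Set G) := by
  obtain ⟨W, hW, hHW⟩ := hH.residualEq_isOpen
  rcases W.eq_empty_or_nonempty with rfl | ⟨w, hw⟩
  · filter_upwards [hHW.mem_iff] with x hx using by simpa using hx
  refine absurd (mem_interior_iff_mem_nhds.2 ?_) (hint ▸ notMem_empty (1 : G))
  have hN : {g : G | g * w ∈ W} ∈ 𝓝 1 := by
    refine (hW.preimage (continuous_mul_const w)).mem_nhds ?_
    simpa using hw
  filter_upwards [hN] with g hg
  -- A generic `x` in the open set `W ∩ gW`, which contains `g * w`, has both `x` and `g⁻¹ * x` in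
  -- `H`, hence `g ∈ H`.
  have hgH := (tendsto_residual_of_isOpenMap (Homeomorph.mulLeft g⁻¹).continuous
    (Homeomorph.mulLeft g⁻¹).isOpenMap).eventually hHW.mem_iff
  obtain ⟨x, hx, hx2⟩ := (dense_of_mem_residual (hgH.and hHW.mem_iff)).inter_open_nonempty
    (W ∩ (fun x => g⁻¹ * x) ⁻¹' W) (hW.inter (hW.preimage (continuous_const_mul _)))
    ⟨g * w, hg, by simpa using hw⟩
  have h1 : x ∈ H := hx2.2.2 hx.1
  have h2 : g⁻¹ * x ∈ H := hx2.1.2 hx.2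
  simpa using H.mul_mem h1 (H.inv_mem h2)

/-- Given countably many nonempty open sets and a relation with meager sections, one can choose a
point in each of the sets so that distinct choices are unrelated. -/
theorem exists_seq_mem_pairwise_notMem_of_isMeagre {X : Type*} [TopologicalSpace X] [BaireSpace X]
    {E : Set (X × X)} (hE₁ : ∀ x, IsMeagre {y | (x, y) ∈ E}) (hE₂ : ∀ x, IsMeagre {y | (y, x) ∈ E})
    (V : ℕ → Set X) (hV : ∀ n, IsOpen (V n)) (hVne : ∀ n, (V n).Nonempty) :
    ∃ y : ℕ → X, (∀ n, y n ∈ V n) ∧ ∀ m n, m ≠ n → (y m, y n) ∉ E := by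
  -- Finitely many earlier points exclude only a meager set, which cannot contain `V n`.
  have key : ∀ (n : ℕ) (s : List X), ∃ y ∈ V n, ∀ x ∈ s, (x, y) ∉ E ∧ (y, x) ∉ E := by
    intro n s
    have hs : ∀ᶠ y in residual X, ∀ x ∈ {x | x ∈ s}, (x, y) ∉ E ∧ (y, x) ∉ E :=
      (eventually_countable_ball s.finite_toSet.countable).2
        fun x _ => Filter.Eventually.and (hE₁ x) (hE₂ x)
    obtain ⟨y, hyV, hy⟩ := (dense_of_mem_residual hs).inter_open_nonempty _ (hV n) (hVne n)
    exact ⟨y, hyV, hy⟩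
  choose g hgV hg using key
  let L : ℕ → List X := fun n => Nat.rec [] (fun n s => g n s :: s) n
  have hL : ∀ m n, m < n → g m (L m) ∈ L n := by
    intro m n hmn
    induction n, hmn using Nat.le_induction with
    | base => exact List.mem_cons_self
    | succ n _ ih => exact List.mem_cons_of_mem _ ih
  refine ⟨fun n => g n (L n), fun n => hgV _ _, fun m n hmn => ?_⟩
  rcases hmn.lt_or_gt with h | h
  exacts [(hg n (L n) _ (hL m n h)).1, (hg m (L m) _ (hL n m h)).2]

/-- Pointwise convergence implies convergence of the laws. -/
theorem MeasureTheory.ProbabilityMeasure.tendsto_map_of_forall_tendsto {Ω X : Type*}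
    [MeasurableSpace Ω] [TopologicalSpace X] [MeasurableSpace X] [OpensMeasurableSpace X]
    (ρ : ProbabilityMeasure Ω) {f : ℕ → Ω → X} {g : Ω → X} (hf : ∀ n, Measurable (f n))
    (hg : Measurable g) (h : ∀ ω, Tendsto (fun n => f n ω) atTop (𝓝 (g ω))) :
    Tendsto (fun n => ρ.map (hf n).aemeasurable) atTop (𝓝 (ρ.map hg.aemeasurable)) := by
  refine ProbabilityMeasure.tendsto_iff_forall_integral_tendsto.2 fun φ => ?_
  simp only [ProbabilityMeasure.toMeasure_map]
  have hφ : ∀ ν : Measure X, AEStronglyMeasurable φ ν := fun ν =>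
    φ.continuous.measurable.aestronglyMeasurable
  simp_rw [integral_map (hf _).aemeasurable (hφ _), integral_map hg.aemeasurable (hφ _)]
  refine tendsto_integral_of_dominated_convergence (fun _ => ‖φ‖)
    (fun n => (φ.continuous.measurable.comp (hf n)).aestronglyMeasurable)
    (integrable_const _) (fun n => .of_forall fun ω => φ.norm_coe_le_norm _)
    (.of_forall fun ω => (φ.continuous.tendsto _).comp (h ω))

theorem MeasureTheory.ProbabilityMeasure.isOpen_setOf_measure_lt_of_isClosed {X : Type*}
    [TopologicalSpace X] [MeasurableSpace X] [OpensMeasurableSpace X] [HasOuterApproxClosed X]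
    {F : Set X} (hF : IsClosed F) (c : ENNReal) :
    IsOpen {μ : ProbabilityMeasure X | (μ : Measure X) F < c} :=
  isOpen_iff_mem_nhds.2 fun _ hμ => eventually_lt_of_limsup_lt
    ((ProbabilityMeasure.limsup_measure_closed_le_of_tendsto tendsto_id hF).trans_lt hμ)

/-- If a closed relation has meager sections, then the measures `μ` for which its `μ × μ`-measure
is small are dense: they are found among the finitely supported measures. -/
theorem MeasureTheory.ProbabilityMeasure.dense_setOf_prod_self_lt {X : Type*} [MetricSpace X]
    [SecondCountableTopology X] [BaireSpace X] [MeasurableSpace X] [BorelSpace X]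
    {E : Set (X × X)} (hE : IsClosed E) (hE₁ : ∀ x, IsMeagre {y | (x, y) ∈ E})
    (hE₂ : ∀ x, IsMeagre {y | (y, x) ∈ E}) {c : ENNReal} (hc : c ≠ 0) :
    Dense {μ : ProbabilityMeasure X | (μ.prod μ : Measure (X × X)) E < c} := by
  intro μ
  have : Nonempty X := μ.nonempty
  obtain ⟨N, hN⟩ := ENNReal.exists_inv_nat_lt hc
  -- An independent uniform label splits each atom into `N + 1` equal ones, placed at distinct
  -- nearby points `y M (Nat.pair i j)`, with `i` the index of a nearest point and `j` the label.
  let u : ProbabilityMeasure (Fin (N + 1)) := ⟨ProbabilityTheory.uniformOn univ, inferInstance⟩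
  have hu : ∀ i, (u : Measure (Fin (N + 1))) {i} = (N + 1 : ENNReal)⁻¹ := fun i => by
    simp [u, ProbabilityTheory.uniformOn_univ]
  let e := TopologicalSpace.denseSeq X
  have hy : ∀ M : ℕ, ∃ y : ℕ → X, (∀ n, dist (y n) (e n.unpair.1) < 1 / (M + 1 : ℝ)) ∧
      ∀ m n, m ≠ n → (y m, y n) ∉ E := fun M =>
    exists_seq_mem_pairwise_notMem_of_isMeagre hE₁ hE₂
      (fun n => Metric.ball (e n.unpair.1) (1 / (M + 1 : ℝ))) (fun _ => Metric.isOpen_ball)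
      fun _ => Metric.nonempty_ball.2 Nat.one_div_pos_of_nat
  choose y hye hyE using hy
  let k : ℕ → X × Fin (N + 1) → ℕ := fun M p =>
    Nat.pair (SimpleFunc.nearestPtInd e M p.1) p.2
  let f : ℕ → X × Fin (N + 1) → X := fun M p => y M (k M p)
  have hf : ∀ M, Measurable (f M) := fun M =>
    (measurable_of_countable fun q : ℕ × Fin (N + 1) => y M (Nat.pair q.1 q.2)).comp
      (((SimpleFunc.nearestPtInd e M).measurable.comp measurable_fst).prodMk measurable_snd)
  have hlim : ∀ p, Tendsto (fun M => f M p) atTop (𝓝 p.1) := by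
    intro p
    have h1 : Tendsto (fun M => SimpleFunc.nearestPt e M p.1) atTop (𝓝 p.1) :=
      SimpleFunc.tendsto_nearestPt (TopologicalSpace.denseRange_denseSeq X p.1)
    refine (tendsto_iff_of_dist (squeeze_zero (fun _ => dist_nonneg) (fun M => ?_)
      tendsto_one_div_add_atTop_nhds_zero_nat)).2 h1
    have := hye M (k M p)
    simp only [k, Nat.unpair_pair] at this
    exact this.le
  have hconv := (μ.prod u).tendsto_map_of_forall_tendsto hf measurable_fst hlim
  rw [ProbabilityMeasure.map_fst_prod] at hconv
  refine mem_closure_of_tendsto hconv (.of_forall fun M => ?_)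
  refine lt_of_le_of_lt ?_ (lt_of_le_of_lt (ENNReal.inv_le_inv.2 ?_) hN : (N + 1 : ENNReal)⁻¹ < c)
  swap
  · exact le_self_add
  set ρ : Measure (X × Fin (N + 1)) := (μ.prod u : Measure (X × Fin (N + 1))) with hρ
  rw [ProbabilityMeasure.toMeasure_prod, ProbabilityMeasure.toMeasure_map,
    Measure.map_prod_map _ _ (hf M) (hf M),
    Measure.map_apply ((hf M).prodMap (hf M)) hE.measurableSet]
  calc (ρ.prod ρ) (Prod.map (f M) (f M) ⁻¹' E)
      -- Related samples have the same index, hence the same label.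
      ≤ (ρ.prod ρ) (⋃ i, (univ ×ˢ {i}) ×ˢ (univ ×ˢ {i})) := by
        refine measure_mono fun q hq => mem_iUnion.2 ⟨q.1.2, ?_⟩
        have hk : k M q.1 = k M q.2 := by_contra fun h => hyE M _ _ h hq
        have := (Nat.pair_eq_pair.1 hk).2
        simpa using (Fin.ext this).symm
    _ ≤ ∑ i, (ρ.prod ρ) ((univ ×ˢ {i}) ×ˢ (univ ×ˢ {i})) := measure_iUnion_fintype_le _ _
    _ = (N + 1 : ENNReal)⁻¹ := by
        simp only [Measure.prod_prod, hρ, ProbabilityMeasure.toMeasure_prod, hu, measure_univ,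
          one_mul, Finset.sum_const, Finset.card_univ, Fintype.card_fin, nsmul_eq_mul,
          Nat.cast_add, Nat.cast_one]
        rw [← mul_assoc, ENNReal.mul_inv_cancel (by simp) (by finiteness), one_mul]

theorem MeasureTheory.ProbabilityMeasure.eventually_residual_prod_self_eq_zero {X : Type*}
    [TopologicalSpace X] [PolishSpace X] [MeasurableSpace X] [BorelSpace X]
    {E : Set (X × X)} (hE : IsClosed E) (hE₁ : ∀ x, IsMeagre {y | (x, y) ∈ E})
    (hE₂ : ∀ x, IsMeagre {y | (y, x) ∈ E}) :
    ∀ᶠ μ : ProbabilityMeasure X in residual (ProbabilityMeasure X),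
      (μ.prod μ : Measure (X × X)) E = 0 := by
  let := TopologicalSpace.upgradeIsCompletelyMetrizable X
  have h : ∀ n : ℕ, ∀ᶠ μ : ProbabilityMeasure X in residual (ProbabilityMeasure X),
      (μ.prod μ : Measure (X × X)) E < (n : ENNReal)⁻¹ := fun n =>
    residual_of_dense_open
      ((ProbabilityMeasure.isOpen_setOf_measure_lt_of_isClosed hE _).preimage
        (ProbabilityMeasure.continuous_prod.comp (continuous_id.prodMk continuous_id)))
      (ProbabilityMeasure.dense_setOf_prod_self_lt hE hE₁ hE₂ (by simp))
  filter_upwards [eventually_countable_forall.2 h] with μ hμ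
  by_contra h0
  obtain ⟨n, hn⟩ := ENNReal.exists_inv_nat_lt h0
  exact (hμ n).not_gt hn

/-- For a meager subgroup `H`, a generic measure vanishes on all cosets, because its square vanishes
on the union `{(x, y) | x⁻¹ * y ∈ H}` of their squares. -/
theorem IsMeagre.leftNullMeasures_mem_residual {G : Type*} [Group G] [TopologicalSpace G]
    [IsTopologicalGroup G] [PolishSpace G] [MeasurableSpace G] [BorelSpace G] {H : Subgroup G}
    (hH : IsMeagre (H : Set G)) : leftNullMeasures (H : Set G) ∈ residual (ProbabilityMeasure G) := by
  obtain ⟨S, hS, hSc, hHS⟩ := isMeagre_iff_countable_union_isNowhereDense.1 hH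
  let D : G × G → G := fun p => p.1⁻¹ * p.2
  have hD : Continuous D := continuous_fst.inv.mul continuous_snd
  have h : ∀ F ∈ S, ∀ᶠ μ : ProbabilityMeasure G in residual (ProbabilityMeasure G),
      (μ.prod μ : Measure (G × G)) (D ⁻¹' closure F) = 0 := by
    intro F hF
    have hm : IsMeagre (closure F) := (hS F hF).closure.isMeagre
    refine ProbabilityMeasure.eventually_residual_prod_self_eq_zero
      (isClosed_closure.preimage hD) (fun x => ?_) fun x => ?_
    · exact hm.preimage_of_isOpenMap (Homeomorph.mulLeft x⁻¹).continuous
        (Homeomorph.mulLeft x⁻¹).isOpenMap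
    · let φ := (Homeomorph.inv G).trans (Homeomorph.mulRight x)
      exact hm.preimage_of_isOpenMap φ.continuous φ.isOpenMap
  filter_upwards [(eventually_countable_ball hSc).2 h] with μ hμ g
  -- Since `(g * a)⁻¹ * (g * b) = a⁻¹ * b`, the cover does not depend on `g`, so uncountably many
  -- cosets cause no difficulty.
  have hsub : (g • (H : Set G)) ×ˢ (g • (H : Set G)) ⊆ ⋃ F ∈ S, D ⁻¹' closure F := by
    rintro ⟨_, _⟩ ⟨⟨a, ha, rfl⟩, ⟨b, hb, rfl⟩⟩
    have hab : a⁻¹ * b ∈ H := H.mul_mem (H.inv_mem ha) hb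
    obtain ⟨F, hF, hx⟩ := hHS hab
    refine mem_biUnion hF (subset_closure ?_)
    simpa [D, mul_assoc] using hx
  have h0 := measure_mono_null hsub ((measure_biUnion_null_iff hSc).2 hμ)
  rw [ProbabilityMeasure.toMeasure_prod, Measure.prod_prod] at h0
  exact mul_self_eq_zero.1 h0

theorem mainTheorem5 {G : Type*} [Group G] [TopologicalSpace G] [IsTopologicalGroup G]
    [PolishSpace G] [Uncountable G] [MeasurableSpace G] [BorelSpace G]
    (H : Subgroup G) (hH : AnalyticSet (H : Set G)) (hint : interior (H : Set G) = ∅) :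
    IsGenericallyLeftHaarNull (H : Set G) :=
  ⟨fun μ _ => hH.nullMeasurableSet μ, IsMeagre.leftNullMeasures_mem_residual
    (Subgroup.isMeagre_of_interior_eq_empty hH.baireMeasurableSet hint)⟩
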